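/- Let $\mathbf k$ be a field of characteristic $0$ and $(A,\lambda)$ a commutative pointed $\mathbf k$-algebra, that is, a commutative unital $\mathbf k$-algebra $A$ with an element $\lambda\in A$. *Objects.* A compatible complete weighted Reynolds algebra over $(A,\lambda)$ is a tuple $(R,R_n,P_R,\lambda_R,i_R)$ in which $R$ is a commutative $A$-algebra with structure map $i_R:A\to R$, $i_R(\lambda)=\lambda_R$; $P_R:R\to R$ is $\mathbf k$-linear with $$P_R(x)P_R(y)=P_R(P_R(x)y)+P_R(xP_R(y))-P_R(P_R(x)\lambda_RP_R(y))\qquad(x,y\in R);$$ $(R_n)_{n\ge0}$ is a decreasing filtration of $R$ by $A$-submodules with $P_R(R_n)\subseteq R_n$ such that $R\to\varprojlim R/R_n$ is bijective; and $R_0=R$, $R_n=\overline{A\,P_R(R_{n-1})}$ for $n\ge1$, where $A\,P_R(R_{n-1})$ is the $A$-submodule generated by $P_R(R_{n-1})$ and the bar is the closure in the topology of the filtration. A morphism is an $A$-algebra homomorphism $f$ with $fP_R=P_{R'}f$, $f(\lambda_R)=\lambda_{R'}$ and $f(R_n)\subseteq R'_n$ for all $n$. We say that $R$ has continuous multiplication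 if for every $y\in R$ the map $x\mapsto xy$ is continuous in the topology of the filtration. *The tensor series.* Put $\widehat{\mathrm{Sh}}(A)=\prod_{k\ge1}A^{\otimes k}$ (tensor powers over $\mathbf k$), $\widehat{\mathrm{Sh}}(A)_n=\prod_{k\ge n+1}A^{\otimes k}$, $P(\mathfrak a)=1_A\otimes\mathfrak a$, and let $j_A:A\to\widehat{\mathrm{Sh}}(A)$ be the inclusion of the first factor. For $\mathfrak a\in A^{\otimes m}$, $\mathfrak b\in A^{\otimes n}$ pure tensors with $m,n\ge1$, the complete shuffle product $\mathfrak a\,\mathbin{\hat{\sqcup\!\sqcup}}\,\mathfrak b\in\prod_rA^{\otimes r}$ is the sum of all extensions of all shuffles of $\mathfrak a$ and $\mathfrak b$; an extension of a shuffle is obtained by inserting arbitrarily many (possibly zero) tensor factors $-\lambda$ in front of each of its factors up to and including the first one that is the last factor of $\mathfrak a$ or the last factor of $\mathfrak b$, and none afterwards; $1_{\mathbf k}\in A^{\otimes0}=\mathbf k$ is a unit for $\mathbin{\hat{\sqcup\!\sqcup}}$. The product $\star$ on $\widehat{\mathrm{Sh}}(A)$ is given by $$(a_0\otimes\mathfrak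 a')\star(b_0\otimes\mathfrak b')=a_0b_0\otimes(\mathfrak a'\,\mathbin{\hat{\sqcup\!\sqcup}}\,\mathfrak b')$$ on pure tensors, extended linearly to series. **Theorem.** With $\star$ as product, $(\widehat{\mathrm{Sh}}(A),\widehat{\mathrm{Sh}}(A)_n,P,j_A(\lambda),j_A)$ is a compatible complete weighted Reynolds algebra over $(A,\lambda)$ with continuous multiplication, and it is the free (initial) one: to every compatible complete weighted Reynolds algebra $R$ over $(A,\lambda)$ there is at most one morphism from $\widehat{\mathrm{Sh}}(A)$, and there is exactly one if $R$ has continuous multiplication or if $A$ is finite-dimensional over $\mathbf k$. -/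

import Mathlib

open scoped TensorProduct

universe u v w

noncomputable section

namespace TensorSeriesReynolds

/-! ### Filtered and operated modules -/

section Filtered

variable {A : Type v} [CommRing A] {R : Type w} [AddCommGroup R] [Module A R]

/-- The closure of a submodule `N` for the topology in which the cosets `x + F n` form a
neighbourhood basis of `x`: every neighbourhood `x + F n` of a point of the closure meets `N`. -/
def filClosure (F : ℕ → Submodule A R) (N : Submodule A R) : Submodule A R where
  carrier := {x | ∀ n, ∃ y ∈ N, x - y ∈ F n}
  zero_mem' := fun _ => ⟨0, N.zero_mem, by simp⟩
  add_mem' := by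
    intro x x' hx hx' n
    obtain ⟨y, hy, h⟩ := hx n
    obtain ⟨y', hy', h'⟩ := hx' n
    refine ⟨y + y', N.add_mem hy hy', ?_⟩
    have e : x + x' - (y + y') = (x - y) + (x' - y') := by abel
    rw [e]
    exact (F n).add_mem h h'
  smul_mem' := by
    intro a x hx n
    obtain ⟨y, hy, h⟩ := hx n
    refine ⟨a • y, N.smul_mem a hy, ?_⟩
    rw [← smul_sub]
    exact (F n).smul_mem a h

/-- The natural map `R → ∏ R / F n`. -/
def toQuotients (F : ℕ → Submodule A R) (x : R) : ∀ n, R ⧸ F n :=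
  fun n => (F n).mkQ x

/-- The inverse limit of the `R / F n`, as the set of families `(r n + F n)` with
`r (n + 1) - r n ∈ F n`. -/
def inverseLimit (F : ℕ → Submodule A R) : Set (∀ n, R ⧸ F n) :=
  {s | ∃ r : ℕ → R, (∀ n, s n = Submodule.Quotient.mk (r n)) ∧ ∀ n, r (n + 1) - r n ∈ F n}

/-- `R` is complete: the natural map from `R` to the inverse limit of the `R / F n` is bijective. -/
def IsCompleteFiltration (F : ℕ → Submodule A R) : Prop :=
  Set.BijOn (toQuotients F) Set.univ (inverseLimit F)

/-- The filtration generated by the operator `P`: it starts with `R`, and the next term is the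
closure of the `A`-submodule generated by the image under `P` of the preceding term. -/
def opFiltration (F : ℕ → Submodule A R) (P : R → R) : ℕ → Submodule A R
  | 0 => ⊤
  | n + 1 => filClosure F (Submodule.span A (P '' (opFiltration F P n : Set R)))

/-- `(R, F, P)` is a compatible complete operated `A`-module: `P` is a `k`-linear operator on the
`A`-module `R` (`k` acts through `A`), `F` is a decreasing filtration by operated submodules for
which `R` is complete, and `F` is the filtration generated by `P`. -/
structure IsCompatibleCompleteOperatedModule (k : Type u) [Field k] [Algebra k A]
    (F : ℕ → Submodule A R) (P : R → R) : Prop where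
  op_add : ∀ x y, P (x + y) = P x + P y
  op_smul : ∀ (c : k) (x : R), P (algebraMap k A c • x) = algebraMap k A c • P x
  antitone : Antitone F
  op_mem : ∀ n, ∀ x ∈ F n, P x ∈ F n
  complete : IsCompleteFiltration F
  generated : ∀ n, F n = opFiltration F P n

end Filtered

/-! ### Compatible complete weighted Reynolds algebras -/

section Reynolds

variable {A : Type v} [CommRing A]

/-- `P` satisfies the Reynolds identity of weight `w`. -/
def IsReynoldsOperator {R : Type w} [CommRing R] (P : R → R) (wt : R) : Prop :=
  ∀ x y, P x * P y = P (P x * y) + P (x * P y) - P (P x * wt * P y)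

/-- `(R, F, P, wt)`, with the structure map `algebraMap A R`, is a compatible complete weighted
Reynolds algebra over the pointed algebra `(A, lam)`. -/
structure IsCompatibleCompleteReynolds (k : Type u) [Field k] [Algebra k A] (lam : A)
    {R : Type w} [CommRing R] [Algebra A R]
    (F : ℕ → Submodule A R) (P : R → R) (wt : R) : Prop where
  map_weight : algebraMap A R lam = wt
  module : IsCompatibleCompleteOperatedModule k F P
  reynolds : IsReynoldsOperator P wt

/-- For every `y`, multiplication by `y` is continuous for the topology of the filtration. -/
def MulContinuous {R : Type w} [CommRing R] [Algebra A R] (F : ℕ → Submodule A R) : Prop :=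
  ∀ (y : R) (n : ℕ), ∃ m, ∀ x ∈ F m, x * y ∈ F n

/-- Homomorphisms of compatible complete weighted Reynolds algebras over `(A, lam)`: homomorphisms
of `A`-algebras that commute with the operators and preserve the filtrations and the weights. -/
structure IsReynoldsHom {R : Type*} [CommRing R] [Algebra A R]
    {R' : Type*} [CommRing R'] [Algebra A R']
    (F : ℕ → Submodule A R) (P : R → R) (wt : R)
    (F' : ℕ → Submodule A R') (P' : R' → R') (wt' : R') (f : R →ₐ[A] R') : Prop where
  map_op : ∀ x, f (P x) = P' (f x)
  map_fil : ∀ n, ∀ x ∈ F n, f x ∈ F' n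
  map_weight : f wt = wt'

end Reynolds

/-! ### Tensor powers and the complete shuffle product -/

section Shuffle

variable (k : Type u) [Field k] {A : Type v} [CommRing A] [Algebra k A]

/-- The bilinear map `(a, t) ↦ a ⊗ t` that adds a tensor factor on the left. -/
def tcons (n : ℕ) : A →ₗ[k] (⨂[k]^n A) →ₗ[k] (⨂[k]^(n + 1) A) :=
  (PiTensorProduct.lift (R := k) (s := fun _ : Fin n => A)
    (E := ⨂[k]^(n + 1) A)).toLinearMap ∘ₗ
    (PiTensorProduct.tprod k (s := fun _ : Fin (n + 1) => A)).curryLeft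

/-- The linear map on `A^{⊗(n+1)}` with `a ⊗ t ↦ g a t`, for a bilinear `g`. -/
def tuncons {M : Type*} [AddCommGroup M] [Module k M] {n : ℕ}
    (g : A →ₗ[k] (⨂[k]^n A) →ₗ[k] M) : (⨂[k]^(n + 1) A) →ₗ[k] M :=
  PiTensorProduct.lift (LinearMap.uncurryLeft (M := fun _ : Fin (n + 1) => A)
    ((PiTensorProduct.lift (R := k) (s := fun _ : Fin n => A) (E := M)).symm.toLinearMap ∘ₗ g))

theorem tcons_tprod {n : ℕ} (a : A) (t : Fin n → A) :
    tcons k n a (PiTensorProduct.tprod k t) =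
      PiTensorProduct.tprod k (Fin.cons a t : Fin (n + 1) → A) := by
  simp [tcons]

theorem tuncons_tcons {M : Type*} [AddCommGroup M] [Module k M] {n : ℕ}
    (g : A →ₗ[k] (⨂[k]^n A) →ₗ[k] M) (a : A) (t : ⨂[k]^n A) :
    tuncons k g (tcons k n a t) = g a t := by
  induction t using PiTensorProduct.induction_on with
  | smul_tprod r f =>
    simp only [map_smul, tcons_tprod]
    simp [tuncons]
  | add x y hx hy => simp [map_add, hx, hy]

theorem tensor_ext {M : Type*} [AddCommGroup M] [Module k M] {n : ℕ}
    {f g : (⨂[k]^(n + 1) A) →ₗ[k] M} (h : ∀ a t, f (tcons k n a t) = g (tcons k n a t)) :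
    f = g := by
  refine PiTensorProduct.ext (MultilinearMap.ext fun t => ?_)
  have e := h (t 0) (PiTensorProduct.tprod k (Fin.tail t))
  rw [tcons_tprod, Fin.cons_self_tail] at e
  simpa using e

/-- The three kinds of positions in an extended shuffle: a factor of the first tensor, a factor of
the second tensor, or an inserted factor `-lam`. -/
inductive Slot
  | fst
  | snd
  | ins
  deriving DecidableEq

instance : Fintype Slot :=
  ⟨{Slot.fst, Slot.snd, Slot.ins}, by intro x; cases x <;> decide⟩

open Classical in
/-- The patterns of length `r` of the extensions of the shuffles of a tensor of length `m` and a
tensor of length `n`: there are `m` positions for the factors of the first tensor and `n` for those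
of the second, and an inserted factor is allowed only as long as neither of the two tensors is
exhausted, that is, it is followed by a factor of the first and by a factor of the second. -/
def extendedShuffles (m n r : ℕ) : Finset (Fin r → Slot) :=
  Finset.univ.filter fun w =>
    (Finset.univ.filter fun p => w p = Slot.fst).card = m ∧
    (Finset.univ.filter fun p => w p = Slot.snd).card = n ∧
    ∀ p, w p = Slot.ins → (∃ q, p < q ∧ w q = Slot.fst) ∧ (∃ q, p < q ∧ w q = Slot.snd)

/-- The tensor of length `r` read off from a pattern `w`: the positions of kind `fst` are filled,
from left to right, with the factors of the first tensor, those of kind `snd` with the factors of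
the second, and those of kind `ins` with `-lam`. (It is zero if the numbers of positions do
not match the lengths of the tensors.) -/
def fill (lam : A) : ∀ r m n : ℕ, (Fin r → Slot) →
    ((⨂[k]^m A) →ₗ[k] (⨂[k]^n A) →ₗ[k] (⨂[k]^r A))
  | 0, 0, 0, _ =>
      LinearMap.lsmul k (⨂[k]^0 A) ∘ₗ
        (TensorPower.algebraMap₀ (R := k) (M := A)).symm.toLinearMap
  | 0, _ + 1, _, _ => 0
  | 0, 0, _ + 1, _ => 0
  | r + 1, m, n, w =>
      match w 0, m, n with
      | Slot.fst, 0, _ => 0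
      | Slot.fst, m + 1, n =>
          tuncons k (LinearMap.mk₂ k
            (fun a s => tcons k r a ∘ₗ fill lam r m n (Fin.tail w) s)
            (fun a a' s => by ext; simp) (fun c a s => by ext; simp)
            (fun a s s' => by ext; simp) (fun c a s => by ext; simp))
      | Slot.snd, _, 0 => 0
      | Slot.snd, m, n + 1 =>
          LinearMap.flip (tuncons k (LinearMap.mk₂ k
            (fun b t => tcons k r b ∘ₗ (fill lam r m n (Fin.tail w)).flip t)
            (fun b b' t => by ext; simp) (fun c b t => by ext; simp)
            (fun b t t' => by ext; simp) (fun c b t => by ext; simp)))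
      | Slot.ins, m, n =>
          (fill lam r m n (Fin.tail w)).compr₂ (tcons k r (-lam))

/-- The component of length `r` of the complete shuffle product of tensors of lengths `m` and `n`:
the sum of all extensions of length `r` of all shuffles of the two tensors. If `m = 0` or `n = 0`
this is the product by a scalar. -/
def completeShuffle (lam : A) (m n r : ℕ) :
    (⨂[k]^m A) →ₗ[k] (⨂[k]^n A) →ₗ[k] (⨂[k]^r A) :=
  ∑ w ∈ extendedShuffles m n r, fill k lam r m n w

/-- The component in `A^{⊗(r+1)}` of the product of elements of `A^{⊗(m+1)}` and `A^{⊗(n+1)}`: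
the product of `a ⊗ s` and `b ⊗ t` is `ab` tensored with the complete shuffle product
of `s` and `t`. -/
def starComponent (lam : A) (m n r : ℕ) :
    (⨂[k]^(m + 1) A) →ₗ[k] (⨂[k]^(n + 1) A) →ₗ[k] (⨂[k]^(r + 1) A) :=
  tuncons k (LinearMap.mk₂ k
    (fun a s => tuncons k (LinearMap.mk₂ k
      (fun b t => tcons k r (a * b) (completeShuffle k lam m n r s t))
      (fun b b' t => by simp [mul_add]) (fun c b t => by simp)
      (fun b t t' => by simp) (fun c b t => by simp)))
    (fun a a' s => tensor_ext k fun b t => by simp [tuncons_tcons, add_mul])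
    (fun c a s => tensor_ext k fun b t => by simp [tuncons_tcons])
    (fun a s s' => tensor_ext k fun b t => by simp [tuncons_tcons])
    (fun c a s => tensor_ext k fun b t => by simp [tuncons_tcons]))

/-! ### The space of tensor series and its structure -/

variable (A) in
/-- The space `∏_{i ≥ 1} A^{⊗i}`; the component with index `n` is the one in `A^{⊗(n+1)}`. -/
def TensorSeries : Type (max u v) := ∀ n : ℕ, ⨂[k]^(n + 1) A

variable {k}

/-- The natural injection of `A` into the space of tensor series. -/
def TensorSeries.of (a : A) : TensorSeries k A
  | 0 => PiTensorProduct.tprod k fun _ => a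
  | _ + 1 => 0

/-- The operator `x ↦ 1 ⊗ x`. -/
def TensorSeries.op (x : TensorSeries k A) : TensorSeries k A
  | 0 => 0
  | n + 1 => tcons k (n + 1) 1 (x n)

/-- The product of tensor series with weight `lam`. Only finitely many pairs of components
contribute to a component of the product, as an extended shuffle is at least as long as the two
tensors together. -/
def TensorSeries.star (lam : A) (x y : TensorSeries k A) : TensorSeries k A :=
  fun r => ∑ m ∈ Finset.range (r + 1), ∑ n ∈ Finset.range (r + 1),
    starComponent k lam m n r (x m) (y n)

end Shuffle

end TensorSeriesReynolds

end

open TensorSeriesReynolds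

/-!
The proof avoids computing with shuffles beyond one recursion. Sorting the patterns of extended
shuffles by their first position gives, for tensors of positive length,
`(a ⊗ s) ⧢ (b ⊗ t) = a ⊗ (s ⧢ (b ⊗ t)) + b ⊗ ((a ⊗ s) ⧢ t) - lam ⊗ ((a ⊗ s) ⧢ (b ⊗ t))`
(`completeShuffle_tcons_tcons`). For the operator `op x = 1 ⊗ x` this is the Reynolds identity
`op x ⋆ op y = op (op x ⋆ y) + op (x ⋆ op y) - op (lam • (op x ⋆ op y))` (`op_starₗ_op`).
Together with the facts that `⋆` is `A`-bilinear for the action on the first factor, that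
`of 1` is a unit and that `⋆` preserves the filtration `fil`, it is all that is used of `⋆`.

Modulo `fil n`, the tensor series are generated as an `A`-module by `of 1` and the image of `op`
(`eq_top_of_mem`), and `op` maps `fil n` to `fil (n + 1)`. Hence identities between `A`-linear maps
can be proved modulo `fil n` by induction on `n`: it suffices to check them on `of 1` and on `op x`,
where the Reynolds identity reduces the precision needed. In this way `⋆` is commutative
(`starₗ_comm`), and then associative (`starₗ_assoc`) because the expansion of
`(op x ⋆ op y) ⋆ op z` is symmetric in `x` and `z`. The same induction proves uniqueness
of morphisms to a compatible complete algebra (`linearMap_unique`).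

For the existence, `a₀ ⊗ a₁ ⊗ ⋯ ⊗ aₙ ↦ a₀ P (a₁ P (⋯ P (aₙ)))` extends by completeness to an
`A`-linear map `f` on series that commutes with the operators (`exists_linearMap`). Let `D` be a submodule of
series that is stable under `op` and whose elements are finite `A`-linear combinations of `of 1` and
elements of `op '' D`. The Reynolds identities on both sides show by induction on `n` that
`f (x ⋆ y) = f x * f y` modulo the `n`-th term of the filtration for `x`, `y` in `D`
(`map_starₗ_of_mem`). If `A` is finite-dimensional, all series form such a `D`, since each
`A^{⊗(n+1)}` is the direct sum of the `bᵢ ⊗ A^{⊗n}` for a finite basis `bᵢ` of `A`. In general the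
finite series do, and continuity of the multiplication does the rest.
-/

namespace TensorSeriesReynolds

/-! ### Recursion for extended shuffles -/

section Patterns

theorem mem_extendedShuffles {m n r : ℕ} {w : Fin r → Slot} :
    w ∈ extendedShuffles m n r ↔
      (Finset.univ.filter fun p => w p = Slot.fst).card = m ∧
      (Finset.univ.filter fun p => w p = Slot.snd).card = n ∧
      ∀ p, w p = Slot.ins → (∃ q, p < q ∧ w q = Slot.fst) ∧ (∃ q, p < q ∧ w q = Slot.snd) := by
  classical
  unfold extendedShuffles
  rw [Finset.mem_filter]
  simp only [Finset.mem_univ, true_and]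

theorem le_of_mem_extendedShuffles {m n r : ℕ} {w : Fin r → Slot}
    (hw : w ∈ extendedShuffles m n r) : m ≤ r ∧ n ≤ r := by
  obtain ⟨h1, h2, -⟩ := mem_extendedShuffles.1 hw
  constructor
  · rw [← h1]; exact (Finset.card_filter_le _ _).trans (by simp)
  · rw [← h2]; exact (Finset.card_filter_le _ _).trans (by simp)

theorem cons_fst_mem_extendedShuffles {m n r : ℕ} {w : Fin r → Slot} :
    (Fin.cons Slot.fst w : Fin (r + 1) → Slot) ∈ extendedShuffles (m + 1) n (r + 1) ↔
      w ∈ extendedShuffles m n r := by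
  simp [mem_extendedShuffles, Fin.card_filter_univ_succ, Fin.forall_fin_succ, Fin.exists_fin_succ]

theorem cons_snd_mem_extendedShuffles {m n r : ℕ} {w : Fin r → Slot} :
    (Fin.cons Slot.snd w : Fin (r + 1) → Slot) ∈ extendedShuffles m (n + 1) (r + 1) ↔
      w ∈ extendedShuffles m n r := by
  simp [mem_extendedShuffles, Fin.card_filter_univ_succ, Fin.forall_fin_succ, Fin.exists_fin_succ]

theorem cons_fst_notMem_extendedShuffles {n r : ℕ} {w : Fin r → Slot} :
    (Fin.cons Slot.fst w : Fin (r + 1) → Slot) ∉ extendedShuffles 0 n (r + 1) := by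
  simp [mem_extendedShuffles, Fin.card_filter_univ_succ]

theorem cons_snd_notMem_extendedShuffles {m r : ℕ} {w : Fin r → Slot} :
    (Fin.cons Slot.snd w : Fin (r + 1) → Slot) ∉ extendedShuffles m 0 (r + 1) := by
  simp [mem_extendedShuffles, Fin.card_filter_univ_succ]

/-- An inserted factor may be put in front of a pattern exactly if neither tensor is empty. -/
theorem cons_ins_mem_extendedShuffles {m n r : ℕ} {w : Fin r → Slot} :
    (Fin.cons Slot.ins w : Fin (r + 1) → Slot) ∈ extendedShuffles m n (r + 1) ↔
      w ∈ extendedShuffles m n r ∧ m ≠ 0 ∧ n ≠ 0 := by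
  have h (x : Slot) : (∃ q, w q = x) ↔ (Finset.univ.filter fun p => w p = x).card ≠ 0 := by
    simp [Finset.filter_eq_empty_iff]
  have e : (Fin.cons Slot.ins w : Fin (r + 1) → Slot) ∈ extendedShuffles m n (r + 1) ↔
      w ∈ extendedShuffles m n r ∧ (∃ q, w q = Slot.fst) ∧ (∃ q, w q = Slot.snd) := by
    simp [mem_extendedShuffles, Fin.card_filter_univ_succ, Fin.forall_fin_succ,
      Fin.exists_fin_succ]
    tauto
  rw [e, h, h]
  constructor
  · rintro ⟨hw, h1, h2⟩
    rw [mem_extendedShuffles] at hw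
    exact ⟨mem_extendedShuffles.2 hw, hw.1 ▸ h1, hw.2.1 ▸ h2⟩
  · rintro ⟨hw, h1, h2⟩
    rw [mem_extendedShuffles] at hw
    exact ⟨mem_extendedShuffles.2 hw, hw.1.symm ▸ h1, hw.2.1.symm ▸ h2⟩

theorem sum_slot {M : Type*} [AddCommMonoid M] (f : Slot → M) :
    ∑ x, f x = f Slot.fst + f Slot.snd + f Slot.ins := by
  have : (Finset.univ : Finset Slot) = {Slot.fst, Slot.snd, Slot.ins} := rfl
  rw [this]
  simp [add_assoc]

end Patterns

/-! ### Recursion for the complete shuffle product -/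

section Shuffle

variable (k : Type u) [Field k] {A : Type v} [CommRing A] [Algebra k A]

open Classical in
theorem completeShuffle_apply_succ (lam : A) (m n r : ℕ) (s : ⨂[k]^m A) (t : ⨂[k]^n A) :
    completeShuffle k lam m n (r + 1) s t =
      ∑ x : Slot, ∑ w : Fin r → Slot,
        if (Fin.cons x w : Fin (r + 1) → Slot) ∈ extendedShuffles m n (r + 1) then
          fill k lam (r + 1) m n (Fin.cons x w : Fin (r + 1) → Slot) s t else 0 := by
  rw [completeShuffle, LinearMap.sum_apply, LinearMap.sum_apply,
    ← Fintype.sum_prod_type', ← (Fin.consEquiv fun _ : Fin (r + 1) => Slot).symm.sum_comp]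
  simp only [Fin.consEquiv, Equiv.coe_fn_symm_mk, Fin.cons_self_tail]
  rw [← Finset.sum_filter]
  simp

theorem completeShuffle_of_lt {lam : A} {m n r : ℕ} (h : r < m ∨ r < n) :
    completeShuffle k lam m n r = 0 := by
  have : extendedShuffles m n r = ∅ := by
    refine Finset.eq_empty_of_forall_notMem fun w hw => ?_
    have := le_of_mem_extendedShuffles hw
    omega
  rw [completeShuffle, this, Finset.sum_empty]

/-- The recursion for the complete shuffle product of two tensors of positive length, by the kind
of the first factor of the extended shuffle. -/
theorem completeShuffle_tcons_tcons (lam : A) (m n r : ℕ) (a b : A)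
    (s : ⨂[k]^m A) (t : ⨂[k]^n A) :
    completeShuffle k lam (m + 1) (n + 1) (r + 1) (tcons k m a s) (tcons k n b t) =
      tcons k r a (completeShuffle k lam m (n + 1) r s (tcons k n b t)) +
      tcons k r b (completeShuffle k lam (m + 1) n r (tcons k m a s) t) -
      tcons k r lam (completeShuffle k lam (m + 1) (n + 1) r (tcons k m a s) (tcons k n b t)) := by
  classical
  rw [completeShuffle_apply_succ, sum_slot]
  simp only [cons_fst_mem_extendedShuffles, cons_snd_mem_extendedShuffles,
    cons_ins_mem_extendedShuffles, ne_eq, Nat.add_eq_zero_iff, one_ne_zero, and_false,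
    not_false_eq_true, and_true]
  rw [← Finset.sum_filter, ← Finset.sum_filter, ← Finset.sum_filter]
  simp [fill, completeShuffle, tuncons_tcons, sub_eq_add_neg, LinearMap.compr₂_apply]

theorem completeShuffle_zero_left (lam : A) (n : ℕ) (s : ⨂[k]^0 A) (t : ⨂[k]^n A) (r : ℕ) (b : A) :
    completeShuffle k lam 0 (n + 1) (r + 1) s (tcons k n b t) =
      tcons k r b (completeShuffle k lam 0 n r s t) := by
  classical
  rw [completeShuffle_apply_succ, sum_slot]
  simp only [cons_fst_notMem_extendedShuffles, cons_snd_mem_extendedShuffles,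
    cons_ins_mem_extendedShuffles, ne_eq, not_true_eq_false, false_and, and_false]
  rw [← Finset.sum_filter]
  simp [fill, completeShuffle, tuncons_tcons]

theorem completeShuffle_zero_right (lam : A) (n : ℕ) (s : ⨂[k]^0 A) (t : ⨂[k]^n A) (r : ℕ) (b : A) :
    completeShuffle k lam (n + 1) 0 (r + 1) (tcons k n b t) s =
      tcons k r b (completeShuffle k lam n 0 r t s) := by
  classical
  rw [completeShuffle_apply_succ, sum_slot]
  simp only [cons_snd_notMem_extendedShuffles, cons_fst_mem_extendedShuffles,
    cons_ins_mem_extendedShuffles, ne_eq, not_true_eq_false, and_false]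
  rw [← Finset.sum_filter]
  simp [fill, completeShuffle, tuncons_tcons]

theorem completeShuffle_zero_zero_succ (lam : A) (r : ℕ) :
    completeShuffle k lam 0 0 (r + 1) = 0 := by
  classical
  refine LinearMap.ext₂ fun s t => ?_
  rw [completeShuffle_apply_succ, sum_slot]
  simp [cons_snd_notMem_extendedShuffles, cons_fst_notMem_extendedShuffles,
    cons_ins_mem_extendedShuffles]

theorem tensor_induction {n : ℕ} {p : (⨂[k]^(n + 1) A) → Prop}
    (tcons : ∀ a t, p (tcons k n a t)) (add : ∀ x y, p x → p y → p (x + y))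
    (x : ⨂[k]^(n + 1) A) : p x := by
  induction x using PiTensorProduct.induction_on with
  | smul_tprod c f =>
    have e := tcons (c • f 0) (PiTensorProduct.tprod k (Fin.tail f))
    rwa [map_smul, LinearMap.smul_apply, tcons_tprod, Fin.cons_self_tail] at e
  | add x y hx hy => exact add x y hx hy

variable (A) in
/-- The empty tensor `1 ∈ A^{⊗0}`. -/
def tunit : ⨂[k]^0 A := TensorPower.algebraMap₀ 1

theorem exists_eq_smul_tunit (s : ⨂[k]^0 A) : ∃ c : k, s = c • tunit k A :=
  ⟨TensorPower.algebraMap₀.symm s, by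
    rw [tunit, ← map_smul, smul_eq_mul, mul_one, LinearEquiv.apply_symm_apply]⟩

theorem tcons_tunit (a : A) :
    tcons k 0 a (tunit k A) = PiTensorProduct.tprod k fun _ => a := by
  rw [tunit, TensorPower.algebraMap₀_one, TensorPower.gOne_def, tcons_tprod]
  congr 1
  ext i
  rw [Fin.fin_one_eq_zero i]
  rfl

theorem completeShuffle_zero_zero_zero (lam : A) :
    completeShuffle k lam 0 0 0 (tunit k A) (tunit k A) = tunit k A := by
  have : extendedShuffles 0 0 0 = {Fin.elim0} := by
    ext w
    simp [mem_extendedShuffles, Subsingleton.elim w Fin.elim0]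
  rw [completeShuffle, this, Finset.sum_singleton]
  simp [fill, tunit]

theorem completeShuffle_tunit_left (lam : A) (n : ℕ) (t : ⨂[k]^n A) :
    completeShuffle k lam 0 n n (tunit k A) t = t := by
  induction n with
  | zero =>
    obtain ⟨c, rfl⟩ := exists_eq_smul_tunit k t
    rw [map_smul, completeShuffle_zero_zero_zero]
  | succ n ih =>
    induction t using tensor_induction with
    | tcons a t => rw [completeShuffle_zero_left, ih]
    | add x y hx hy => rw [map_add, hx, hy]

theorem completeShuffle_tunit_right (lam : A) (n : ℕ) (t : ⨂[k]^n A) :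
    completeShuffle k lam n 0 n t (tunit k A) = t := by
  induction n with
  | zero =>
    obtain ⟨c, rfl⟩ := exists_eq_smul_tunit k t
    rw [map_smul, LinearMap.smul_apply, completeShuffle_zero_zero_zero]
  | succ n ih =>
    induction t using tensor_induction with
    | tcons a t => rw [completeShuffle_zero_right, ih]
    | add x y hx hy => rw [map_add, LinearMap.add_apply, hx, hy]

theorem completeShuffle_zero_left_of_ne (lam : A) {n r : ℕ} (h : n ≠ r) (s : ⨂[k]^0 A)
    (t : ⨂[k]^n A) : completeShuffle k lam 0 n r s t = 0 := by
  induction n generalizing r with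
  | zero =>
    obtain ⟨r, rfl⟩ := Nat.exists_eq_succ_of_ne_zero h.symm
    simp [completeShuffle_zero_zero_succ]
  | succ n ih =>
    cases r with
    | zero => simp [completeShuffle_of_lt]
    | succ r =>
      induction t using tensor_induction with
      | tcons a t => rw [completeShuffle_zero_left, ih (by omega), map_zero]
      | add x y hx hy => rw [map_add, hx, hy, add_zero]

theorem completeShuffle_zero_right_of_ne (lam : A) {n r : ℕ} (h : n ≠ r) (t : ⨂[k]^n A)
    (s : ⨂[k]^0 A) : completeShuffle k lam n 0 r t s = 0 := by
  induction n generalizing r with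
  | zero =>
    obtain ⟨r, rfl⟩ := Nat.exists_eq_succ_of_ne_zero h.symm
    simp [completeShuffle_zero_zero_succ]
  | succ n ih =>
    cases r with
    | zero => simp [completeShuffle_of_lt]
    | succ r =>
      induction t using tensor_induction with
      | tcons a t => rw [completeShuffle_zero_right, ih (by omega), map_zero]
      | add x y hx hy => rw [map_add, LinearMap.add_apply, hx, hy, add_zero]

theorem starComponent_tcons_tcons (lam : A) (m n r : ℕ) (a b : A) (s : ⨂[k]^m A) (t : ⨂[k]^n A) :
    starComponent k lam m n r (tcons k m a s) (tcons k n b t) =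
      tcons k r (a * b) (completeShuffle k lam m n r s t) := by
  simp [starComponent, tuncons_tcons]

theorem starComponent_of_lt (lam : A) {m n r : ℕ} (h : r < m ∨ r < n) :
    starComponent k lam m n r = 0 := by
  refine tensor_ext k fun a s => tensor_ext k fun b t => ?_
  rw [starComponent_tcons_tcons, completeShuffle_of_lt k h]
  simp

end Shuffle

/-! ### The action of `A` on the first factor -/

section Module

variable {k : Type u} [Field k] {A : Type v} [CommRing A] [Algebra k A]

/-- Multiplication of the first factor of a tensor by `a`. -/
def mulFirst (a : A) (n : ℕ) : (⨂[k]^(n + 1) A) →ₗ[k] (⨂[k]^(n + 1) A) :=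
  tuncons k (tcons k n ∘ₗ LinearMap.mulLeft k a)

@[simp]
theorem mulFirst_tcons (a b : A) (n : ℕ) (t : ⨂[k]^n A) :
    mulFirst a n (tcons k n b t) = tcons k n (a * b) t := by
  simp [mulFirst, tuncons_tcons]

theorem mulFirst_one (n : ℕ) (x : ⨂[k]^(n + 1) A) : mulFirst 1 n x = x := by
  induction x using tensor_induction with
  | tcons b t => simp
  | add y z hy hz => rw [map_add, hy, hz]

theorem mulFirst_mul (a b : A) (n : ℕ) (x : ⨂[k]^(n + 1) A) :
    mulFirst (a * b) n x = mulFirst a n (mulFirst b n x) := by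
  induction x using tensor_induction with
  | tcons b t => simp [mul_assoc]
  | add y z hy hz => simp only [map_add, hy, hz]

theorem mulFirst_add (a b : A) (n : ℕ) (x : ⨂[k]^(n + 1) A) :
    mulFirst (a + b) n x = mulFirst a n x + mulFirst b n x := by
  induction x using tensor_induction with
  | tcons b t => simp [add_mul]
  | add y z hy hz => rw [map_add, hy, hz, map_add, map_add]; abel

theorem mulFirst_algebraMap (c : k) (n : ℕ) (x : ⨂[k]^(n + 1) A) :
    mulFirst (algebraMap k A c) n x = c • x := by
  induction x using tensor_induction with
  | tcons b t => rw [mulFirst_tcons, ← Algebra.smul_def, map_smul, LinearMap.smul_apply]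
  | add y z hy hz => rw [map_add, hy, hz, smul_add]

theorem starComponent_mulFirst_left (lam a : A) (m n r : ℕ) (x : ⨂[k]^(m + 1) A)
    (y : ⨂[k]^(n + 1) A) :
    starComponent k lam m n r (mulFirst a m x) y =
      mulFirst a r (starComponent k lam m n r x y) := by
  induction x using tensor_induction with
  | add x x' hx hx' => simp [hx, hx']
  | tcons b s =>
    induction y using tensor_induction with
    | add y y' hy hy' => rw [map_add, map_add, map_add, hy, hy']
    | tcons c t => simp [starComponent_tcons_tcons, mul_assoc]

theorem starComponent_mulFirst_right (lam a : A) (m n r : ℕ) (x : ⨂[k]^(m + 1) A)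
    (y : ⨂[k]^(n + 1) A) :
    starComponent k lam m n r x (mulFirst a n y) =
      mulFirst a r (starComponent k lam m n r x y) := by
  induction x using tensor_induction with
  | add x x' hx hx' => simp [hx, hx']
  | tcons b s =>
    induction y using tensor_induction with
    | add y y' hy hy' => simp only [map_add, hy, hy']
    | tcons c t => simp [starComponent_tcons_tcons, mul_left_comm]

namespace TensorSeries

instance : AddCommGroup (TensorSeries k A) :=
  inferInstanceAs (AddCommGroup (∀ n, ⨂[k]^(n + 1) A))

@[ext]
protected theorem ext {x y : TensorSeries k A} (h : ∀ n, x n = y n) : x = y := funext h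

@[simp] theorem add_apply (x y : TensorSeries k A) (n : ℕ) : (x + y) n = x n + y n := rfl

@[simp] theorem sub_apply (x y : TensorSeries k A) (n : ℕ) : (x - y) n = x n - y n := rfl

@[simp] theorem zero_apply (n : ℕ) : (0 : TensorSeries k A) n = 0 := rfl

instance : SMul A (TensorSeries k A) := ⟨fun a x n => mulFirst a n (x n)⟩

@[simp] theorem smul_apply (a : A) (x : TensorSeries k A) (n : ℕ) :
    (a • x) n = mulFirst a n (x n) := rfl

instance : Module A (TensorSeries k A) where
  one_smul x := TensorSeries.ext fun n => mulFirst_one n _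
  mul_smul a b x := TensorSeries.ext fun n => mulFirst_mul a b n _
  smul_zero a := TensorSeries.ext fun n => map_zero _
  smul_add a x y := TensorSeries.ext fun n => map_add _ _ _
  add_smul a b x := TensorSeries.ext fun n => mulFirst_add a b n _
  zero_smul x := TensorSeries.ext fun n => by
    rw [smul_apply, ← map_zero (algebraMap k A), mulFirst_algebraMap, zero_smul, zero_apply]

end TensorSeries
end Module

/-! ### Filtration and product of tensor series -/

section Series

variable {k : Type u} [Field k] {A : Type v} [CommRing A] [Algebra k A]

/-- The complete shuffle product of two tensors of positive length, expressed by products in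
which one or both of them are preceded by the factor `1`. -/
theorem completeShuffle_eq_starComponent (lam : A) (m n r : ℕ) (x : ⨂[k]^(m + 1) A)
    (y : ⨂[k]^(n + 1) A) :
    completeShuffle k lam (m + 1) (n + 1) (r + 1) x y =
      starComponent k lam (m + 1) n r (tcons k (m + 1) 1 x) y +
      starComponent k lam m (n + 1) r x (tcons k (n + 1) 1 y) -
      mulFirst lam r (starComponent k lam (m + 1) (n + 1) r
        (tcons k (m + 1) 1 x) (tcons k (n + 1) 1 y)) := by
  induction x using tensor_induction with
  | add x x' hx hx' => simp only [map_add, LinearMap.add_apply, hx, hx']; abel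
  | tcons a s =>
    induction y using tensor_induction with
    | add y y' hy hy' => simp only [map_add, hy, hy']; abel
    | tcons b t =>
      rw [completeShuffle_tcons_tcons]
      simp only [starComponent_tcons_tcons, mulFirst_tcons, mul_one, one_mul]
      abel

namespace TensorSeries

@[simp] theorem op_zero_apply (x : TensorSeries k A) : op x 0 = 0 := rfl

@[simp] theorem op_succ_apply (x : TensorSeries k A) (n : ℕ) :
    op x (n + 1) = tcons k (n + 1) 1 (x n) := rfl

theorem op_add (x y : TensorSeries k A) : op (x + y) = op x + op y := by
  ext (_ | n) <;> simp

theorem op_sub (x y : TensorSeries k A) : op (x - y) = op x - op y := by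
  ext (_ | n) <;> simp

theorem op_algebraMap_smul (c : k) (x : TensorSeries k A) :
    op (algebraMap k A c • x) = algebraMap k A c • op x := by
  ext (_ | n)
  · simp
  · simp only [op_succ_apply, smul_apply, mulFirst_algebraMap, map_smul]

theorem of_zero_apply (a : A) : of (k := k) a 0 = tcons k 0 a (tunit k A) := (tcons_tunit k a).symm

@[simp] theorem of_succ_apply (a : A) (n : ℕ) : of (k := k) a (n + 1) = 0 := rfl

theorem of_eq_smul (a : A) : of (k := k) a = a • of 1 := by
  ext (_ | n) <;> simp [of_zero_apply]

variable (k A) in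
/-- The filtration of the space of tensor series by the length of the tensors. -/
def fil (n : ℕ) : Submodule A (TensorSeries k A) where
  carrier := {x | ∀ i < n, x i = 0}
  zero_mem' := fun i _ => rfl
  add_mem' := fun hx hy i hi => by simp [hx i hi, hy i hi]
  smul_mem' := fun a x hx i hi => by simp [hx i hi]

theorem mem_fil {n : ℕ} {x : TensorSeries k A} : x ∈ fil k A n ↔ ∀ i < n, x i = 0 := Iff.rfl

theorem fil_zero : fil k A 0 = ⊤ := by
  ext x; simp [mem_fil]

theorem fil_antitone : Antitone (fil k A) := fun _ _ h _ hx i hi => hx i (hi.trans_le h)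

theorem op_mem_fil {n : ℕ} {x : TensorSeries k A} (hx : x ∈ fil k A n) :
    op x ∈ fil k A (n + 1) := by
  rintro (_ | i) hi
  · rfl
  · rw [op_succ_apply, hx i (by omega), map_zero]

theorem eq_zero_of_forall_mem_fil {x : TensorSeries k A} (h : ∀ n, x ∈ fil k A n) : x = 0 :=
  TensorSeries.ext fun n => h (n + 1) n n.lt_succ_self

/-- The series with a single component. -/
def single (n : ℕ) (t : ⨂[k]^(n + 1) A) : TensorSeries k A :=
  Pi.single (M := fun n => ⨂[k]^(n + 1) A) n t

@[simp] theorem single_same (n : ℕ) (t : ⨂[k]^(n + 1) A) : single n t n = t :=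
  Pi.single_eq_same (M := fun n => ⨂[k]^(n + 1) A) n t

theorem single_of_ne {n i : ℕ} (h : i ≠ n) (t : ⨂[k]^(n + 1) A) : single n t i = 0 :=
  Pi.single_eq_of_ne (M := fun n => ⨂[k]^(n + 1) A) h t

theorem single_zero (n : ℕ) : single n (0 : ⨂[k]^(n + 1) A) = 0 :=
  Pi.single_zero (M := fun n => ⨂[k]^(n + 1) A) n

theorem single_add (n : ℕ) (s t : ⨂[k]^(n + 1) A) : single n (s + t) = single n s + single n t :=
  Pi.single_add (f := fun n => ⨂[k]^(n + 1) A) n s t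

/-- As `A^{⊗0} = k`, a tensor of length one is a multiple of `1`. -/
theorem single_zero_tcons (a : A) (s : ⨂[k]^0 A) :
    ∃ b : A, single 0 (tcons k 0 a s) = b • of 1 := by
  obtain ⟨c, rfl⟩ := exists_eq_smul_tunit k s
  refine ⟨c • a, ?_⟩
  rw [← of_eq_smul]
  ext (_ | n)
  · simp [of_zero_apply]
  · rw [single_of_ne (by omega), of_succ_apply]

theorem single_succ_tcons (n : ℕ) (a : A) (t : ⨂[k]^(n + 1) A) :
    single (n + 1) (tcons k (n + 1) a t) = a • op (single n t) := by
  ext i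
  rcases i with _ | i
  · rw [single_of_ne (by omega), smul_apply, op_zero_apply, map_zero]
  · rw [smul_apply, op_succ_apply, mulFirst_tcons, mul_one]
    rcases eq_or_ne i n with rfl | h
    · simp
    · rw [single_of_ne h, single_of_ne (by omega), map_zero]

theorem sum_apply {ι : Type*} (s : Finset ι) (f : ι → TensorSeries k A) (n : ℕ) :
    (∑ i ∈ s, f i) n = ∑ i ∈ s, f i n :=
  Finset.sum_apply (M := fun n => ⨂[k]^(n + 1) A) n s f

theorem sum_single_apply (x : TensorSeries k A) (n i : ℕ) :
    (∑ j ∈ Finset.range n, single j (x j)) i = if i < n then x i else 0 := by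
  rw [sum_apply]
  split_ifs with h
  · exact (Finset.sum_eq_single i (fun j _ hj => single_of_ne hj.symm _) (by simp [h])).trans
      (single_same _ _)
  · refine Finset.sum_eq_zero fun j hj => single_of_ne ?_ _
    rintro rfl
    exact h (Finset.mem_range.1 hj)

theorem sub_sum_single_mem (x : TensorSeries k A) (n : ℕ) :
    x - ∑ j ∈ Finset.range n, single j (x j) ∈ fil k A n := fun i hi => by
  rw [sub_apply, sum_single_apply, if_pos hi, sub_self]

/-- Modulo tensors of length `> n`, the `A`-module of tensor series is generated by `1` and the
image of the operator. -/
theorem eq_top_of_mem {N : Submodule A (TensorSeries k A)} (n : ℕ) (one : of 1 ∈ N)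
    (op_mem : ∀ x, op x ∈ N) (fil_le : fil k A n ≤ N) (x : TensorSeries k A) : x ∈ N := by
  rw [← sub_add_cancel x (∑ j ∈ Finset.range n, single j (x j))]
  refine N.add_mem (fil_le (sub_sum_single_mem x n)) (N.sum_mem fun j _ => ?_)
  induction x j using tensor_induction with
  | add s t hs ht => rw [single_add]; exact N.add_mem hs ht
  | tcons a t =>
    cases j with
    | zero =>
      obtain ⟨b, hb⟩ := single_zero_tcons a t
      rw [hb]
      exact N.smul_mem _ one
    | succ j =>
      rw [single_succ_tcons]
      exact N.smul_mem _ (op_mem _)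

/-- The product of tensor series as an `A`-bilinear map. -/
def starₗ (lam : A) : TensorSeries k A →ₗ[A] TensorSeries k A →ₗ[A] TensorSeries k A :=
  LinearMap.mk₂ A (star lam)
    (fun x y z => by ext r; simp [star, Finset.sum_add_distrib])
    (fun a x y => by ext r; simp [star, starComponent_mulFirst_left])
    (fun x y z => by ext r; simp [star, Finset.sum_add_distrib])
    (fun a x y => by ext r; simp [star, starComponent_mulFirst_right])

theorem starₗ_apply_apply (lam : A) (x y : TensorSeries k A) (r : ℕ) :
    starₗ lam x y r = ∑ m ∈ Finset.range (r + 1), ∑ n ∈ Finset.range (r + 1),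
      starComponent k lam m n r (x m) (y n) := rfl

theorem starₗ_mem_fil_left (lam : A) {n : ℕ} {x : TensorSeries k A} (hx : x ∈ fil k A n)
    (y : TensorSeries k A) : starₗ lam x y ∈ fil k A n := fun r hr => by
  rw [starₗ_apply_apply]
  refine Finset.sum_eq_zero fun m hm => Finset.sum_eq_zero fun i _ => ?_
  rw [hx m (by have := Finset.mem_range.1 hm; omega), map_zero, LinearMap.zero_apply]

theorem starₗ_mem_fil_right (lam : A) {n : ℕ} {y : TensorSeries k A} (hy : y ∈ fil k A n)
    (x : TensorSeries k A) : starₗ lam x y ∈ fil k A n := fun r hr => by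
  rw [starₗ_apply_apply]
  refine Finset.sum_eq_zero fun m _ => Finset.sum_eq_zero fun i hi => ?_
  rw [hy i (by have := Finset.mem_range.1 hi; omega), map_zero]

theorem one_starₗ (lam : A) (x : TensorSeries k A) : starₗ lam (of 1) x = x := by
  ext r
  rw [starₗ_apply_apply, Finset.sum_eq_single 0, Finset.sum_eq_single r]
  · rw [of_zero_apply]
    induction x r using tensor_induction with
    | add s t hs ht => rw [map_add, hs, ht]
    | tcons a t => rw [starComponent_tcons_tcons, completeShuffle_tunit_left, one_mul]
  · intro n _ hn
    rw [of_zero_apply]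
    induction x n using tensor_induction with
    | add s t hs ht => rw [map_add, hs, ht, add_zero]
    | tcons a t =>
      rw [starComponent_tcons_tcons, completeShuffle_zero_left_of_ne k lam hn, map_zero]
  · simp
  · rintro (_ | m) _ hm
    · exact absurd rfl hm
    · simp
  · simp

theorem starₗ_one (lam : A) (x : TensorSeries k A) : starₗ lam x (of 1) = x := by
  ext r
  rw [starₗ_apply_apply, Finset.sum_comm, Finset.sum_eq_single 0, Finset.sum_eq_single r]
  · rw [of_zero_apply]
    induction x r using tensor_induction with
    | add s t hs ht => rw [map_add, LinearMap.add_apply, hs, ht]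
    | tcons a t => rw [starComponent_tcons_tcons, completeShuffle_tunit_right, mul_one]
  · intro n _ hn
    rw [of_zero_apply]
    induction x n using tensor_induction with
    | add s t hs ht => rw [map_add, LinearMap.add_apply, hs, ht, add_zero]
    | tcons a t =>
      rw [starComponent_tcons_tcons, completeShuffle_zero_right_of_ne k lam hn, map_zero]
  · simp
  · rintro (_ | m) _ hm
    · exact absurd rfl hm
    · simp
  · simp

/-- The components of a product with a factor `op x`, with the range of summation left as for `x`:
the additional summand with `m = r` vanishes, the tensor being too long. -/
theorem op_starₗ_apply (lam : A) (x y : TensorSeries k A) (r : ℕ) :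
    starₗ lam (op x) y r = ∑ m ∈ Finset.range (r + 1), ∑ n ∈ Finset.range (r + 1),
      starComponent k lam (m + 1) n r (tcons k (m + 1) 1 (x m)) (y n) := by
  rw [starₗ_apply_apply, Finset.sum_range_succ']
  simp only [op_zero_apply, map_zero, LinearMap.zero_apply, Finset.sum_const_zero, add_zero]
  rw [Finset.sum_range_succ _ r]
  simp [starComponent_of_lt]

theorem starₗ_op_apply (lam : A) (x y : TensorSeries k A) (r : ℕ) :
    starₗ lam x (op y) r = ∑ m ∈ Finset.range (r + 1), ∑ n ∈ Finset.range (r + 1),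
      starComponent k lam m (n + 1) r (x m) (tcons k (n + 1) 1 (y n)) := by
  rw [starₗ_apply_apply]
  refine Finset.sum_congr rfl fun m _ => ?_
  rw [Finset.sum_range_succ', Finset.sum_range_succ]
  simp [starComponent_of_lt]

theorem op_starₗ_op_apply (lam : A) (x y : TensorSeries k A) (r : ℕ) :
    starₗ lam (op x) (op y) r = ∑ m ∈ Finset.range (r + 1), ∑ n ∈ Finset.range (r + 1),
      starComponent k lam (m + 1) (n + 1) r (tcons k (m + 1) 1 (x m))
        (tcons k (n + 1) 1 (y n)) := by
  rw [op_starₗ_apply]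
  refine Finset.sum_congr rfl fun m _ => ?_
  rw [Finset.sum_range_succ', Finset.sum_range_succ]
  simp [starComponent_of_lt]

/-- The Reynolds identity for the product of tensor series. -/
theorem op_starₗ_op (lam : A) (x y : TensorSeries k A) :
    starₗ lam (op x) (op y) =
      op (starₗ lam (op x) y) + op (starₗ lam x (op y)) - op (lam • starₗ lam (op x) (op y)) := by
  ext (_ | r)
  · simp [starₗ_apply_apply]
  · have h : starₗ lam (op x) (op y) (r + 1) = ∑ m ∈ Finset.range (r + 1),
        ∑ n ∈ Finset.range (r + 1), starComponent k lam (m + 1) (n + 1) (r + 1)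
          (tcons k (m + 1) 1 (x m)) (tcons k (n + 1) 1 (y n)) := by
      rw [starₗ_apply_apply, Finset.sum_range_succ']
      simp [Finset.sum_range_succ' _ (r + 1)]
    rw [h, sub_apply, add_apply, op_succ_apply, op_succ_apply, op_succ_apply, smul_apply,
      op_starₗ_op_apply, op_starₗ_apply, starₗ_op_apply, ← map_add, ← map_sub]
    rw [map_sum, ← Finset.sum_add_distrib, ← Finset.sum_sub_distrib, map_sum]
    refine Finset.sum_congr rfl fun m _ => ?_
    rw [map_sum, ← Finset.sum_add_distrib, ← Finset.sum_sub_distrib, map_sum]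
    refine Finset.sum_congr rfl fun n _ => ?_
    rw [starComponent_tcons_tcons, one_mul, completeShuffle_eq_starComponent]

/-! ### Commutativity and associativity -/

theorem op_smodEq {n : ℕ} {x y : TensorSeries k A} (h : x ≡ y [SMOD fil k A n]) :
    op x ≡ op y [SMOD fil k A (n + 1)] := by
  rw [SModEq.sub_mem] at h ⊢
  rw [← op_sub]
  exact op_mem_fil h

/-- Two `A`-linear maps on the tensor series agree modulo a submodule as soon as they do so on `1`,
on the image of the operator, and on the long tensors. -/
theorem linearMap_smodEq {M : Type*} [AddCommGroup M] [Module A M] {N : Submodule A M}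
    (L L' : TensorSeries k A →ₗ[A] M) (n : ℕ) (one : L (of 1) ≡ L' (of 1) [SMOD N])
    (op : ∀ x, L (op x) ≡ L' (op x) [SMOD N])
    (fil : ∀ x ∈ fil k A n, L x ∈ N ∧ L' x ∈ N) (x : TensorSeries k A) :
    L x ≡ L' x [SMOD N] := by
  have h := eq_top_of_mem (N := N.comap (L - L')) n (SModEq.sub_mem.1 one)
    (fun x => SModEq.sub_mem.1 (op x)) (fun x hx => N.sub_mem (fil x hx).1 (fil x hx).2) x
  exact SModEq.sub_mem.2 h

/-- Both orders of the factors satisfy the same Reynolds identity, so that commutativity modulo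
`fil k A n` propagates to `fil k A (n + 1)`. -/
theorem starₗ_comm_smodEq (lam : A) (n : ℕ) (x y : TensorSeries k A) :
    starₗ lam x y ≡ starₗ lam y x [SMOD fil k A n] := by
  induction n generalizing x y with
  | zero => rw [fil_zero]; exact SModEq.top
  | succ n ih =>
    refine linearMap_smodEq ((starₗ lam).flip y) (starₗ lam y) (n + 1) ?_ (fun x => ?_)
      (fun x hx => ⟨starₗ_mem_fil_left lam hx _, starₗ_mem_fil_right lam hx _⟩) x
    · rw [LinearMap.flip_apply, one_starₗ, starₗ_one]
    rw [LinearMap.flip_apply]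
    refine linearMap_smodEq (starₗ lam (op x)) ((starₗ lam).flip (op x)) (n + 1) ?_ (fun y => ?_)
      (fun y hy => ⟨starₗ_mem_fil_right lam hy _, starₗ_mem_fil_left lam hy _⟩) y
    · rw [LinearMap.flip_apply, one_starₗ, starₗ_one]
    rw [LinearMap.flip_apply]
    have h := ((op_smodEq (ih (op x) y)).add (op_smodEq (ih x (op y)))).sub
      (op_smodEq ((ih (op x) (op y)).smul lam))
    rwa [← op_starₗ_op, add_comm (op (starₗ lam y (op x))), ← op_starₗ_op] at h

theorem starₗ_comm (lam : A) (x y : TensorSeries k A) : starₗ lam x y = starₗ lam y x :=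
  sub_eq_zero.1 (eq_zero_of_forall_mem_fil fun n => SModEq.sub_mem.1 (starₗ_comm_smodEq lam n x y))

/-- The product of three elements in the image of the operator. -/
theorem op_starₗ_op_starₗ_op (lam : A) (x y z : TensorSeries k A) :
    starₗ lam (starₗ lam (op x) (op y)) (op z) =
      op (starₗ lam (starₗ lam (op x) (op y)) z) + op (starₗ lam (starₗ lam (op x) y) (op z)) +
      op (starₗ lam (starₗ lam x (op y)) (op z)) -
      op (lam • starₗ lam (starₗ lam (op x) (op y)) (op z)) -
      op (lam • starₗ lam (starₗ lam (op x) (op y)) (op z)) := by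
  have h : starₗ lam (op x) (op y) =
      op (starₗ lam (op x) y + starₗ lam x (op y) - lam • starₗ lam (op x) (op y)) := by
    rw [op_sub, op_add, ← op_starₗ_op]
  have e := op_starₗ_op lam
    (starₗ lam (op x) y + starₗ lam x (op y) - lam • starₗ lam (op x) (op y)) z
  rw [← h] at e
  refine e.trans ?_
  simp only [map_add, map_sub, map_smul, LinearMap.add_apply, LinearMap.sub_apply,
    LinearMap.smul_apply, op_add, op_sub]
  abel

/-- Given commutativity, associativity amounts to invariance of triple products under exchange of
the outer factors, and the expansion of `op_starₗ_op_starₗ_op` is symmetric in this sense. -/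
theorem starₗ_swap_smodEq (lam : A) (n : ℕ) (x y z : TensorSeries k A) :
    starₗ lam (starₗ lam x y) z ≡ starₗ lam (starₗ lam z y) x [SMOD fil k A n] := by
  induction n generalizing x y z with
  | zero => rw [fil_zero]; exact SModEq.top
  | succ n ih =>
    refine linearMap_smodEq ((starₗ lam).flip z ∘ₗ (starₗ lam).flip y) (starₗ lam (starₗ lam z y))
      (n + 1) ?_ (fun x => ?_) (fun x hx => ?_) x
    rotate_right
    · simp only [LinearMap.comp_apply, LinearMap.flip_apply]
      exact ⟨starₗ_mem_fil_left lam (starₗ_mem_fil_left lam hx _) _, starₗ_mem_fil_right lam hx _⟩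
    · simp only [LinearMap.comp_apply, LinearMap.flip_apply, one_starₗ, starₗ_one]
      rw [starₗ_comm]
    simp only [LinearMap.comp_apply, LinearMap.flip_apply]
    refine linearMap_smodEq ((starₗ lam).flip z ∘ₗ starₗ lam (op x))
      ((starₗ lam).flip (op x) ∘ₗ starₗ lam z) (n + 1) ?_ (fun y => ?_)
      (fun y hy => ?_) y
    rotate_right
    · simp only [LinearMap.comp_apply, LinearMap.flip_apply]
      exact ⟨starₗ_mem_fil_left lam (starₗ_mem_fil_right lam hy _) _,
        starₗ_mem_fil_left lam (starₗ_mem_fil_right lam hy _) _⟩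
    · simp only [LinearMap.comp_apply, LinearMap.flip_apply, starₗ_one]
      rw [starₗ_comm]
    simp only [LinearMap.comp_apply, LinearMap.flip_apply]
    refine linearMap_smodEq (starₗ lam (starₗ lam (op x) (op y)))
      ((starₗ lam).flip (op x) ∘ₗ (starₗ lam).flip (op y)) (n + 1) ?_ (fun z => ?_)
      (fun z hz => ?_) z
    rotate_right
    · simp only [LinearMap.comp_apply, LinearMap.flip_apply]
      exact ⟨starₗ_mem_fil_right lam hz _, starₗ_mem_fil_left lam (starₗ_mem_fil_left lam hz _) _⟩
    · simp only [LinearMap.comp_apply, LinearMap.flip_apply, one_starₗ, starₗ_one]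
      rw [starₗ_comm]
    simp only [LinearMap.comp_apply, LinearMap.flip_apply]
    have h := op_smodEq ((ih (op x) (op y) (op z)).smul lam)
    have e := ((((op_smodEq (ih (op x) (op y) z)).add (op_smodEq (ih (op x) y (op z)))).add
      (op_smodEq (ih x (op y) (op z)))).sub h).sub h
    -- exchanging the outer factors reverses the order of the first three terms
    rwa [← op_starₗ_op_starₗ_op, add_right_comm,
      add_comm (op (starₗ lam (starₗ lam z (op y)) (op x))), add_right_comm,
      ← op_starₗ_op_starₗ_op] at e

theorem starₗ_assoc (lam : A) (x y z : TensorSeries k A) :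
    starₗ lam (starₗ lam x y) z = starₗ lam x (starₗ lam y z) := by
  rw [starₗ_comm lam x (starₗ lam y z), starₗ_comm lam y z]
  exact sub_eq_zero.1 (eq_zero_of_forall_mem_fil fun n =>
    SModEq.sub_mem.1 (starₗ_swap_smodEq lam n x y z))

/-- The ring of tensor series of weight `lam`. -/
@[reducible] def commRing (lam : A) : CommRing (TensorSeries k A) where
  __ := (inferInstance : AddCommGroup (TensorSeries k A))
  mul := star lam
  one := of 1
  mul_assoc := starₗ_assoc lam
  one_mul := one_starₗ lam
  mul_one := starₗ_one lam
  left_distrib x := map_add (starₗ lam x)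
  right_distrib x y z := congrArg (· z) (map_add (starₗ lam) x y)
  zero_mul x := congrArg (· x) (map_zero (starₗ lam))
  mul_zero x := map_zero (starₗ lam x)
  mul_comm := starₗ_comm lam

/-- The `A`-algebra of tensor series of weight `lam`, in which `A` acts on the first factors. -/
@[reducible] def algebra (lam : A) :
    letI := commRing (k := k) lam
    Algebra A (TensorSeries k A) :=
  letI := commRing (k := k) lam
  Algebra.ofModule (fun a x y => congrArg (· y) (map_smul (starₗ lam) a x))
    fun a x y => map_smul (starₗ lam x) a y

end TensorSeries
end Series

/-! ### The free compatible complete operated module -/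

section OperatedModule

variable {k : Type u} [Field k] {A : Type v} [CommRing A] [Algebra k A]
  {M : Type w} [AddCommGroup M] [Module A M] {F : ℕ → Submodule A M} {P : M → M}

namespace IsCompatibleCompleteOperatedModule

theorem fil_zero (h : IsCompatibleCompleteOperatedModule k F P) : F 0 = ⊤ := h.generated 0

theorem op_mem_succ (h : IsCompatibleCompleteOperatedModule k F P) {n : ℕ} {x : M}
    (hx : x ∈ F n) : P x ∈ F (n + 1) := by
  rw [h.generated] at hx ⊢
  exact fun m => ⟨P x, Submodule.subset_span ⟨x, hx, rfl⟩, by simp⟩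

theorem op_sub (h : IsCompatibleCompleteOperatedModule k F P) (x y : M) :
    P (x - y) = P x - P y := by
  rw [eq_sub_iff_add_eq, ← h.op_add, sub_add_cancel]

theorem op_smodEq (h : IsCompatibleCompleteOperatedModule k F P) {n : ℕ} {x y : M}
    (hxy : x ≡ y [SMOD F n]) : P x ≡ P y [SMOD F (n + 1)] := by
  rw [SModEq.sub_mem] at hxy ⊢
  rw [← h.op_sub]
  exact h.op_mem_succ hxy

theorem eq_of_forall_smodEq (h : IsCompatibleCompleteOperatedModule k F P) {x y : M}
    (hxy : ∀ n, x ≡ y [SMOD F n]) : x = y :=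
  h.complete.injOn (Set.mem_univ x) (Set.mem_univ y) (funext hxy)

/-- A sequence with `s (n + 1) - s n ∈ F n` has a limit, by surjectivity onto the inverse limit. -/
theorem exists_limit (h : IsCompatibleCompleteOperatedModule k F P) (s : ℕ → M)
    (hs : ∀ n, s (n + 1) - s n ∈ F n) : ∃ x, ∀ n, x ≡ s n [SMOD F n] := by
  obtain ⟨x, -, hx⟩ := h.complete.surjOn
    (show (fun n => (F n).mkQ (s n)) ∈ inverseLimit F from ⟨s, fun n => rfl, hs⟩)
  exact ⟨x, fun n => congrFun hx n⟩

end IsCompatibleCompleteOperatedModule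

namespace TensorSeries

theorem fil_isCompatible : IsCompatibleCompleteOperatedModule k (fil k A) op where
  op_add := op_add
  op_smul := op_algebraMap_smul
  antitone := fil_antitone
  op_mem n x hx := fil_antitone n.le_succ (op_mem_fil hx)
  complete := by
    refine ⟨fun x _ => ⟨fun _ => x, fun n => rfl, by simp⟩, fun x _ y _ hxy => ?_, ?_⟩
    · exact sub_eq_zero.1 (eq_zero_of_forall_mem_fil fun n => SModEq.sub_mem.1 (congrFun hxy n))
    · rintro s ⟨r, hs, hr⟩
      have hr' : ∀ n m, n ≤ m → ∀ i < n, r m i = r n i := by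
        intro n m hnm i hi
        induction m, hnm using Nat.le_induction with
        | base => rfl
        | succ m hm ih => rw [← ih]; exact sub_eq_zero.1 (hr m i (by omega))
      -- the component with index `i` is constant along the sequence `r` from `i + 1` on
      refine ⟨fun i => r (i + 1) i, Set.mem_univ _, funext fun n => ?_⟩
      rw [hs]
      refine SModEq.sub_mem.2 fun i hi => sub_eq_zero.2 ?_
      exact (hr' (i + 1) n hi i i.lt_succ_self).symm
  generated n := by
    induction n with
    | zero => exact fil_zero
    | succ n ih =>
      rw [opFiltration, ← ih]
      apply le_antisymm
      · intro x hx m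
        refine ⟨_, Submodule.sum_mem _ fun j _ => ?_, sub_sum_single_mem x m⟩
        by_cases hj : j < n + 1
        · rw [hx j hj, single_zero]
          exact Submodule.zero_mem _
        · obtain ⟨j, rfl⟩ : ∃ i, j = i + 1 := ⟨j - 1, by omega⟩
          induction x (j + 1) using tensor_induction with
          | add s t hs ht => rw [single_add]; exact Submodule.add_mem _ hs ht
          | tcons a t =>
            rw [single_succ_tcons]
            refine Submodule.smul_mem _ _ (Submodule.subset_span ⟨_, fun i hi => ?_, rfl⟩)
            exact single_of_ne (by omega) _
      · intro x hx
        obtain ⟨y, hy, hxy⟩ := hx (n + 1)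
        rw [← sub_add_cancel x y]
        refine add_mem hxy (Submodule.span_le.2 ?_ hy)
        rintro _ ⟨z, hz, rfl⟩
        exact op_mem_fil hz

/-- Linear maps from the tensor series that are compatible with operators and filtrations are
determined by their value at `1`. -/
theorem linearMap_unique (h : IsCompatibleCompleteOperatedModule k F P)
    {f g : TensorSeries k A →ₗ[A] M} (one : f (of 1) = g (of 1))
    (hf : ∀ x, f (op x) = P (f x)) (hg : ∀ x, g (op x) = P (g x))
    (hf' : ∀ n, ∀ x ∈ fil k A n, f x ∈ F n) (hg' : ∀ n, ∀ x ∈ fil k A n, g x ∈ F n) : f = g := by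
  refine LinearMap.ext fun x => h.eq_of_forall_smodEq fun n => ?_
  induction n generalizing x with
  | zero => rw [h.fil_zero]; exact SModEq.top
  | succ n ih =>
    refine linearMap_smodEq f g (n + 1) (by rw [one]) (fun x => ?_)
      (fun x hx => ⟨hf' _ x hx, hg' _ x hx⟩) x
    rw [hf, hg]
    exact h.op_smodEq (ih x)

end TensorSeries

section Lift

variable [Module k M] [IsScalarTower k A M]

/-- The map `a ⊗ t ↦ a • g t`. -/
def smulTail {n : ℕ} (g : (⨂[k]^n A) →ₗ[k] M) : (⨂[k]^(n + 1) A) →ₗ[k] M :=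
  tuncons k ((Algebra.lsmul k k M).toLinearMap.compl₂ g)

theorem smulTail_tcons {n : ℕ} (g : (⨂[k]^n A) →ₗ[k] M) (a : A) (t : ⨂[k]^n A) :
    smulTail g (tcons k n a t) = a • g t := by
  simp [smulTail, tuncons_tcons]

theorem smulTail_mulFirst {n : ℕ} (g : (⨂[k]^n A) →ₗ[k] M) (a : A) (t : ⨂[k]^(n + 1) A) :
    smulTail g (mulFirst a n t) = a • smulTail g t := by
  induction t using tensor_induction with
  | tcons b t => rw [mulFirst_tcons, smulTail_tcons, smulTail_tcons, mul_smul]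
  | add s t hs ht => rw [map_add, map_add, hs, ht, map_add, smul_add]

/-- The map `a₁ ⊗ ⋯ ⊗ aₙ ↦ P (a₁ • P (a₂ • ⋯ P (aₙ • e)))`. -/
def nestedOp (P : M →ₗ[k] M) (e : M) : ∀ n, (⨂[k]^n A) →ₗ[k] M
  | 0 => LinearMap.toSpanSingleton k M e ∘ₗ
      (TensorPower.algebraMap₀ (R := k) (M := A)).symm.toLinearMap
  | n + 1 => P ∘ₗ smulTail (nestedOp P e n)

theorem nestedOp_tunit (P : M →ₗ[k] M) (e : M) : nestedOp P e 0 (tunit k A) = e := by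
  simp [nestedOp, tunit]

theorem smulTail_nestedOp_mem {P : M →ₗ[k] M}
    (h : IsCompatibleCompleteOperatedModule k F P) (e : M) (n : ℕ) (t : ⨂[k]^(n + 1) A) :
    smulTail (nestedOp P e n) t ∈ F n := by
  induction n with
  | zero => rw [h.fil_zero]; trivial
  | succ n ih =>
    induction t using tensor_induction with
    | add s t hs ht => rw [map_add]; exact add_mem hs ht
    | tcons a t =>
      rw [smulTail_tcons]
      exact Submodule.smul_mem _ _ (h.op_mem_succ (ih t))

/-- The partial sums of the image of a tensor series. -/
def partialSum (P : M →ₗ[k] M) (e : M) (x : TensorSeries k A) (n : ℕ) : M :=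
  ∑ j ∈ Finset.range n, smulTail (nestedOp P e j) (x j)

theorem partialSum_op (P : M →ₗ[k] M) (e : M) (x : TensorSeries k A) (n : ℕ) :
    partialSum P e x.op (n + 1) = P (partialSum P e x n) := by
  rw [partialSum, partialSum, Finset.sum_range_succ', map_sum]
  simp [smulTail_tcons, nestedOp]

theorem exists_linearMap_of_linear {P : M →ₗ[k] M}
    (h : IsCompatibleCompleteOperatedModule k F P) (e : M) :
    ∃ f : TensorSeries k A →ₗ[A] M, f (TensorSeries.of 1) = e ∧
      (∀ x, f (TensorSeries.op x) = P (f x)) ∧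
      ∀ n, ∀ x ∈ TensorSeries.fil k A n, f x ∈ F n := by
  have hlim (x : TensorSeries k A) : ∃ y, ∀ n, y ≡ partialSum P e x n [SMOD F n] := by
    refine h.exists_limit _ fun n => ?_
    rw [partialSum, Finset.sum_range_succ, partialSum, add_sub_cancel_left]
    exact smulTail_nestedOp_mem h e n (x n)
  choose f hf using hlim
  have uniq {x : TensorSeries k A} {y : M} (hy : ∀ n, y ≡ partialSum P e x n [SMOD F n]) :
      f x = y := h.eq_of_forall_smodEq fun n => (hf x n).trans (hy n).symm
  -- the partial sum with index `0` carries no information, as `F 0 = ⊤`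
  have uniq' {x : TensorSeries k A} {y : M}
      (hy : ∀ n, y ≡ partialSum P e x (n + 1) [SMOD F (n + 1)]) : f x = y := by
    refine uniq fun n => ?_
    cases n with
    | zero => rw [h.fil_zero]; exact SModEq.top
    | succ n => exact hy n
  refine ⟨⟨⟨f, fun x y => uniq fun n => ?_⟩, fun a x => uniq fun n => ?_⟩, uniq' fun n => ?_,
    fun x => uniq' fun n => ?_, fun n x hx => ?_⟩
  · have e : partialSum P e (x + y) n = partialSum P e x n + partialSum P e y n := by
      simp [partialSum, Finset.sum_add_distrib]
    rw [e]
    exact (hf x n).add (hf y n)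
  · have e : partialSum P e (a • x) n = a • partialSum P e x n := by
      simp [partialSum, Finset.smul_sum, smulTail_mulFirst]
    rw [e]
    exact (hf x n).smul a
  · rw [partialSum, Finset.sum_range_succ']
    simp [TensorSeries.of_zero_apply, smulTail_tcons, nestedOp_tunit]
  · rw [partialSum_op]
    exact h.op_smodEq (hf x n)
  · have e : partialSum P e x n = 0 :=
      Finset.sum_eq_zero fun j hj => by rw [hx j (Finset.mem_range.1 hj), map_zero]
    have := hf x n
    rw [e] at this
    exact SModEq.zero.1 this

end Lift

/-- The space of tensor series is the free compatible complete operated `A`-module on one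
generator. -/
theorem exists_linearMap (h : IsCompatibleCompleteOperatedModule k F P) (e : M) :
    ∃ f : TensorSeries k A →ₗ[A] M, f (TensorSeries.of 1) = e ∧
      (∀ x, f (TensorSeries.op x) = P (f x)) ∧
      ∀ n, ∀ x ∈ TensorSeries.fil k A n, f x ∈ F n := by
  -- `k` acts on `M` through `A`
  let : Module k M := Module.compHom M (algebraMap k A)
  have : IsScalarTower k A M := ⟨fun c a x => by rw [Algebra.smul_def, mul_smul]; rfl⟩
  exact exists_linearMap_of_linear (P := ⟨⟨P, h.op_add⟩, h.op_smul⟩) h e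

end OperatedModule

/-! ### Multiplicativity of the universal map -/

section Multiplicative

variable {k : Type u} [Field k] {A : Type v} [CommRing A] [Algebra k A] {lam : A}
  {R : Type w} [CommRing R] [Algebra A R] {F : ℕ → Submodule A R} {P : R → R} {wt : R}

open TensorSeries

theorem op_mul_op (h : IsCompatibleCompleteReynolds k lam F P wt) (x y : R) :
    P x * P y = P (P x * y) + P (x * P y) - P (lam • (P x * P y)) := by
  have e : P x * wt * P y = lam • (P x * P y) := by
    rw [← h.map_weight, Algebra.smul_def, mul_comm (P x), mul_assoc]
  rw [← e]
  exact h.reynolds x y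

/-- A linear map that preserves `1` and the operators is multiplicative on every submodule of the
tensor series that is stable under the operator and on which every element is an `A`-linear
combination of finitely many elements `1` and `op x`: the Reynolds identity reduces the
multiplicativity modulo `F (n + 1)` to that modulo `F n`. -/
theorem map_starₗ_of_mem (h : IsCompatibleCompleteReynolds k lam F P wt)
    {f : TensorSeries k A →ₗ[A] R} (one : f (of 1) = 1) (hf : ∀ x, f (op x) = P (f x))
    {D : Submodule A (TensorSeries k A)} (hD : ∀ x ∈ D, op x ∈ D)
    (hD' : D ≤ Submodule.span A (insert (of 1) (op '' D))) {x y : TensorSeries k A}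
    (hx : x ∈ D) (hy : y ∈ D) : f (starₗ lam x y) = f x * f y := by
  -- linear maps agree on `D` modulo `F n` if they do so on `1` and on the `op x` with `x ∈ D`
  have key (n : ℕ) (L L' : TensorSeries k A →ₗ[A] R) (h1 : L (of 1) ≡ L' (of 1) [SMOD F n])
      (h2 : ∀ x ∈ D, L (op x) ≡ L' (op x) [SMOD F n]) (x : TensorSeries k A) (hx : x ∈ D) :
      L x ≡ L' x [SMOD F n] := by
    have : D ≤ (F n).comap (L - L') := by
      refine hD'.trans (Submodule.span_le.2 ?_)
      rintro _ (rfl | ⟨x, hx, rfl⟩)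
      · exact SModEq.sub_mem.1 h1
      · exact SModEq.sub_mem.1 (h2 x hx)
    exact SModEq.sub_mem.2 (this hx)
  refine h.module.eq_of_forall_smodEq fun n => ?_
  induction n generalizing x y with
  | zero => rw [h.module.fil_zero]; exact SModEq.top
  | succ n ih =>
    refine key (n + 1) (f ∘ₗ (starₗ lam).flip y) (LinearMap.mulRight A (f y) ∘ₗ f) ?_
      (fun x hx => ?_) x hx
    · simp only [LinearMap.comp_apply, LinearMap.flip_apply, one_starₗ, LinearMap.mulRight_apply,
        one, one_mul]
      rfl
    simp only [LinearMap.comp_apply, LinearMap.flip_apply, LinearMap.mulRight_apply]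
    refine key (n + 1) (f ∘ₗ starₗ lam (op x)) (LinearMap.mulLeft A (f (op x)) ∘ₗ f) ?_
      (fun y hy => ?_) y hy
    · simp only [LinearMap.comp_apply, starₗ_one, LinearMap.mulLeft_apply, one, mul_one]
      rfl
    simp only [LinearMap.comp_apply, LinearMap.mulLeft_apply]
    have e := ((h.module.op_smodEq (ih (hD x hx) hy)).add
      (h.module.op_smodEq (ih hx (hD y hy)))).sub
      (h.module.op_smodEq ((ih (hD x hx) (hD y hy)).smul lam))
    rw [hf x, hf y, ← op_mul_op h, ← map_smul, ← hf, ← hf, ← hf, ← map_add, ← map_sub,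
      ← op_starₗ_op] at e
    rwa [hf x, hf y]

variable (k A) in
/-- The submodule of the series with finitely many components. -/
def finiteSeries : Submodule A (TensorSeries k A) where
  carrier := {x | ∃ n, ∀ i, n ≤ i → x i = 0}
  zero_mem' := ⟨0, fun _ _ => rfl⟩
  add_mem' := by
    rintro x y ⟨m, hm⟩ ⟨n, hn⟩
    exact ⟨max m n, fun i hi => by
      rw [TensorSeries.add_apply, hm i ((le_max_left _ _).trans hi),
        hn i ((le_max_right _ _).trans hi),
        add_zero]⟩
  smul_mem' := by
    rintro a x ⟨m, hm⟩
    exact ⟨m, fun i hi => by rw [TensorSeries.smul_apply, hm i hi, map_zero]⟩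

theorem single_mem_finiteSeries (n : ℕ) (t : ⨂[k]^(n + 1) A) : single n t ∈ finiteSeries k A :=
  ⟨n + 1, fun _ hi => single_of_ne (by omega) t⟩

theorem op_mem_finiteSeries (x : TensorSeries k A) (hx : x ∈ finiteSeries k A) :
    op x ∈ finiteSeries k A := by
  obtain ⟨n, hn⟩ := hx
  refine ⟨n + 1, ?_⟩
  rintro (_ | i) hi
  · rfl
  · rw [op_succ_apply, hn i (by omega), map_zero]

theorem finiteSeries_le_span :
    finiteSeries k A ≤ Submodule.span A (insert (of 1) (op '' (finiteSeries k A : Set _))) := by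
  rintro x ⟨n, hn⟩
  have e : x = ∑ j ∈ Finset.range n, single j (x j) := by
    ext i
    rw [sum_single_apply]
    split_ifs with hi
    · rfl
    · exact hn i (not_lt.1 hi)
  rw [e]
  refine Submodule.sum_mem _ fun j _ => ?_
  induction x j using tensor_induction with
  | add s t hs ht => rw [single_add]; exact Submodule.add_mem _ hs ht
  | tcons a t =>
    cases j with
    | zero =>
      obtain ⟨b, hb⟩ := single_zero_tcons a t
      rw [hb]
      exact Submodule.smul_mem _ _ (Submodule.subset_span (Set.mem_insert _ _))
    | succ j =>
      rw [single_succ_tcons]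
      exact Submodule.smul_mem _ _ (Submodule.subset_span
        (Set.mem_insert_of_mem _ ⟨_, single_mem_finiteSeries _ _, rfl⟩))

/-- If `A` is finite-dimensional, with basis `b`, then every series, even an infinite one, is a
finite sum `a • 1 + ∑ i, b i • op (x i)`. -/
theorem mem_span_of_finiteDimensional [FiniteDimensional k A] (x : TensorSeries k A) :
    x ∈ Submodule.span A (insert (of 1) (op '' (Set.univ : Set (TensorSeries k A)))) := by
  let b := Module.finBasis k A
  have hb (n : ℕ) (t : ⨂[k]^(n + 1) A) :
      ∃ s : Fin (Module.finrank k A) → ⨂[k]^n A, t = ∑ i, tcons k n (b i) (s i) := by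
    induction t using tensor_induction with
    | add t t' ht ht' =>
      obtain ⟨s, rfl⟩ := ht
      obtain ⟨s', rfl⟩ := ht'
      exact ⟨s + s', by simp [Finset.sum_add_distrib]⟩
    | tcons a t =>
      refine ⟨fun i => b.repr a i • t, ?_⟩
      conv_lhs => rw [← b.sum_repr a]
      simp only [map_sum, map_smul, LinearMap.sum_apply, LinearMap.smul_apply]
  obtain ⟨y, hy⟩ : ∃ y : Fin (Module.finrank k A) → TensorSeries k A,
      ∀ n, x (n + 1) = ∑ i, tcons k (n + 1) (b i) (y i n) := by
    choose s hs using fun n => hb (n + 1) (x (n + 1))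
    exact ⟨fun i n => s n i, hs⟩
  have e : x = single 0 (x 0) + ∑ i, b i • op (y i) := by
    ext (_ | n)
    · rw [TensorSeries.add_apply, single_same, TensorSeries.sum_apply,
        Finset.sum_eq_zero fun i _ => ?_, add_zero]
      exact map_zero (mulFirst (b i) 0)
    · rw [TensorSeries.add_apply, single_of_ne (by omega), zero_add, TensorSeries.sum_apply]
      refine (hy n).trans (Finset.sum_congr rfl fun i _ => ?_)
      rw [TensorSeries.smul_apply, op_succ_apply, mulFirst_tcons, mul_one]
  rw [e]
  refine add_mem ?_ (Submodule.sum_mem _ fun i _ => Submodule.smul_mem _ _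
    (Submodule.subset_span (Set.mem_insert_of_mem _ ⟨_, Set.mem_univ _, rfl⟩)))
  induction x 0 using tensor_induction with
  | add s t hs ht => rw [single_add]; exact Submodule.add_mem _ hs ht
  | tcons a t =>
    obtain ⟨c, hc⟩ := single_zero_tcons a t
    rw [hc]
    exact Submodule.smul_mem _ _ (Submodule.subset_span (Set.mem_insert _ _))

theorem map_starₗ_of_finiteDimensional [FiniteDimensional k A]
    (h : IsCompatibleCompleteReynolds k lam F P wt)
    {f : TensorSeries k A →ₗ[A] R} (one : f (of 1) = 1) (hf : ∀ x, f (op x) = P (f x))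
    (x y : TensorSeries k A) : f (starₗ lam x y) = f x * f y :=
  map_starₗ_of_mem h one hf (D := ⊤) (fun _ _ => trivial)
    (fun x _ => mem_span_of_finiteDimensional x) (Submodule.mem_top (x := x))
    (Submodule.mem_top (x := y))

theorem map_starₗ_of_mulContinuous (hF : MulContinuous F)
    (h : IsCompatibleCompleteReynolds k lam F P wt)
    {f : TensorSeries k A →ₗ[A] R} (one : f (of 1) = 1) (hf : ∀ x, f (op x) = P (f x))
    (hf' : ∀ n, ∀ x ∈ fil k A n, f x ∈ F n)
    (x y : TensorSeries k A) : f (starₗ lam x y) = f x * f y := by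
  -- by continuity of both sides in `x`, multiplicativity extends from finite series `x` to all `x`
  have key (y : TensorSeries k A)
      (hy : ∀ x ∈ finiteSeries k A, f (starₗ lam x y) = f x * f y) (x : TensorSeries k A) :
      f (starₗ lam x y) = f x * f y := by
    refine h.module.eq_of_forall_smodEq fun n => SModEq.sub_mem.2 ?_
    obtain ⟨m, hm⟩ := hF (f y) n
    set x' := ∑ j ∈ Finset.range (max m n), single j (x j)
    have hx' : x' ∈ finiteSeries k A := sum_mem fun j _ => single_mem_finiteSeries _ _
    have hd : x - x' ∈ fil k A (max m n) := sub_sum_single_mem x _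
    have e : f (starₗ lam x y) - f x * f y =
        f (starₗ lam (x - x') y) - f (x - x') * f y := by
      simp only [map_sub, LinearMap.sub_apply, hy x' hx', sub_mul]
      abel
    rw [e]
    refine sub_mem (hf' n _ (starₗ_mem_fil_left lam (fil_antitone (le_max_right _ _) hd) y))
      (hm _ (hf' m _ (fil_antitone (le_max_left _ _) hd)))
  refine key y (fun x hx => ?_) x
  rw [starₗ_comm, mul_comm]
  exact key x (fun y hy =>
    map_starₗ_of_mem h one hf op_mem_finiteSeries finiteSeries_le_span hy hx) y

end Multiplicative
end TensorSeriesReynolds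

/-! ### The universal property -/

theorem mainTheorem2 {k : Type u} [Field k] [CharZero k] {A : Type v} [CommRing A] [Algebra k A]
    (lam : A) :
    ∃ (_ : CommRing (TensorSeries k A)) (_ : Algebra A (TensorSeries k A))
      (F : ℕ → Submodule A (TensorSeries k A)),
      -- the structure on the space of tensor series
      (∀ (x y : TensorSeries k A) (n : ℕ), (x + y) n = x n + y n) ∧
      (∀ x y : TensorSeries k A, x * y = TensorSeries.star lam x y) ∧
      (∀ a : A, algebraMap A (TensorSeries k A) a = TensorSeries.of a) ∧
      (∀ (n : ℕ) (x : TensorSeries k A), x ∈ F n ↔ ∀ i < n, x i = 0) ∧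
      -- it is an object of the category, with continuous multiplication
      IsCompatibleCompleteReynolds k lam F TensorSeries.op (TensorSeries.of lam) ∧
      MulContinuous F ∧
      -- the universal property
      ∀ (R : Type w) [CommRing R] [Algebra A R] (FR : ℕ → Submodule A R) (PR : R → R) (wR : R),
        IsCompatibleCompleteReynolds k lam FR PR wR →
          (∀ f g : TensorSeries k A →ₐ[A] R,
            IsReynoldsHom F TensorSeries.op (TensorSeries.of lam) FR PR wR f →
            IsReynoldsHom F TensorSeries.op (TensorSeries.of lam) FR PR wR g → f = g) ∧
          (MulContinuous FR ∨ FiniteDimensional k A →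
            ∃ f : TensorSeries k A →ₐ[A] R,
              IsReynoldsHom F TensorSeries.op (TensorSeries.of lam) FR PR wR f) := by
  let := TensorSeries.commRing (k := k) lam
  let := TensorSeries.algebra (k := k) lam
  have algebraMap_eq (a : A) : algebraMap A (TensorSeries k A) a = TensorSeries.of a := by
    rw [Algebra.algebraMap_eq_smul_one]
    exact (TensorSeries.of_eq_smul a).symm
  have mul_eq (x y : TensorSeries k A) : x * y = TensorSeries.starₗ lam x y := rfl
  refine ⟨TensorSeries.commRing lam, TensorSeries.algebra lam, TensorSeries.fil k A,
    fun _ _ _ => rfl, fun _ _ => rfl, algebraMap_eq, fun _ _ => Iff.rfl,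
    ⟨algebraMap_eq lam, TensorSeries.fil_isCompatible, fun x y => ?_⟩,
    fun y n => ⟨n, fun x hx => TensorSeries.starₗ_mem_fil_left lam hx y⟩, ?_⟩
  · have e : TensorSeries.op x * TensorSeries.of lam * TensorSeries.op y =
        lam • (TensorSeries.op x * TensorSeries.op y) := by
      rw [Algebra.smul_def, algebraMap_eq, mul_comm (TensorSeries.op x), mul_assoc]
    rw [e]
    exact TensorSeries.op_starₗ_op lam x y
  · intro R _ _ FR PR wR h
    refine ⟨fun f g hf hg => ?_, fun hR => ?_⟩
    · have := TensorSeries.linearMap_unique h.module (f := f.toLinearMap) (g := g.toLinearMap)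
        ((map_one f).trans (map_one g).symm) hf.map_op hg.map_op hf.map_fil hg.map_fil
      exact AlgHom.toLinearMap_injective this
    · obtain ⟨f, one, hop, hfil⟩ := exists_linearMap h.module (1 : R)
      have hmul : ∀ x y, f (TensorSeries.starₗ lam x y) = f x * f y := by
        rcases hR with hR | hR
        · exact map_starₗ_of_mulContinuous hR h one hop hfil
        · exact map_starₗ_of_finiteDimensional h one hop
      refine ⟨AlgHom.ofLinearMap f one hmul, hop, hfil, ?_⟩
      rw [← algebraMap_eq, AlgHom.commutes, h.map_weight]
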